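/- Let $\Lambda$ denote the von Mangoldt function, i.e. $\Lambda(n)=\log p$ if $n=p^k$ for a prime $p$ and an integer $k\ge 1$, and $\Lambda(n)=0$ otherwise. Then the prime number theorem holds in the form \[ \frac{1}{N}\sum_{n\le N}\Lambda(n) = 1 + o_{N\to\infty}(1), \] where $N$ and $n$ range over the positive integers; that is, $\lim_{N\to\infty}\left(\frac1N\sum_{n\le N}\Lambda(n)-1\right)=0$. -/

import Mathlib

open scoped ArithmeticFunction.vonMangoldt
open scoped Asymptotics

/-!
The proof is the Wiener-Ikehara argument, shortened by Chebyshev's bound `ψ x = O(x)`.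

Put `a t = ψ (exp t) * exp (-t)`; the claim is that `a t → 1`. By partial summation the Laplace
transform of `a - 1` on `0 < re z` is `(L(Λ, 1 + z) - 1 / z - 1) / (1 + z)`, and since `ζ` does not
vanish on `re s = 1` this extends continuously to `0 ≤ re z`
(`integral_psiExp_sub_one_mul_exp`, with Mathlib's `LFunctionResidueClassAux` for the modulus `1`).

The rest is a Tauberian theorem, `tendsto_one_of_laplace_continuousOn`. The Fejér kernel is
nonnegative and integrable, and it is the Fourier transform of a function of compact support, the
tent. Fubini therefore expresses the convolution of `a - 1` with a Fejér kernel of any width through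
the values of the Laplace transform on a compact vertical segment. As `a` is bounded, the segment
can be moved to the imaginary axis by dominated convergence (`integral_mul_fejer_eq_boundary`), and
the Riemann-Lebesgue lemma shows that the convolution tends to `0`. So all Fejér averages of `a`
tend to `1` (up to normalization). Finally, `a t * exp t` is monotone, so `a` cannot drop much
over short intervals, and narrow averages of `a` control `a` itself from both sides.
-/

open MeasureTheory Filter Topology Set

/-! ### The tent function and the Fejér kernel -/

/-- The tent function, supported on `[-1, 1]` with maximum `1` at `0`. -/
noncomputable def tent (y : ℝ) : ℝ := max 0 (1 - |y|)

/-- The Fejér kernel `(sin (t / 2) / (t / 2)) ^ 2`, not normalized to have integral `1`. It is the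
Fourier transform of the tent function, with frequency convention `exp (i t y)`. -/
noncomputable def fejer (t : ℝ) : ℝ := Real.sinc (t / 2) ^ 2

lemma continuous_tent : Continuous tent := by
  unfold tent; fun_prop

lemma tent_eq_zero {y : ℝ} (hy : y ∉ Ioc (-1 : ℝ) 1) : tent y = 0 := by
  refine max_eq_left (sub_nonpos.mpr ?_)
  by_contra! h
  exact hy ⟨(abs_lt.mp h).1, (abs_lt.mp h).2.le⟩

lemma integral_tent_mul (f : ℝ → ℂ) :
    ∫ y, (tent y : ℂ) * f y = ∫ y in (-1 : ℝ)..1, (tent y : ℂ) * f y := by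
  rw [intervalIntegral.integral_of_le (by norm_num),
    setIntegral_eq_integral_of_forall_compl_eq_zero]
  intro y hy
  simp [tent_eq_zero hy]

lemma integrable_tent : Integrable (fun y ↦ (tent y : ℂ)) := by
  refine (Complex.continuous_ofReal.comp continuous_tent).integrable_of_hasCompactSupport ?_
  refine HasCompactSupport.intro (isCompact_Icc (a := (-1 : ℝ)) (b := 1)) fun y hy ↦ ?_
  simp [tent_eq_zero fun h ↦ hy (Ioc_subset_Icc_self h)]

lemma integral_one_sub_mul_exp {c : ℂ} (hc : c ≠ 0) :
    ∫ y in (0 : ℝ)..1, (1 - y : ℂ) * Complex.exp (c * y) = (Complex.exp c - 1 - c) / c ^ 2 := by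
  have hd : ∀ y : ℝ, HasDerivAt
      (fun y : ℝ ↦ (1 - y : ℂ) * Complex.exp (c * y) / c + Complex.exp (c * y) / c ^ 2)
      ((1 - y : ℂ) * Complex.exp (c * y)) y := by
    intro y
    have he : HasDerivAt (fun y : ℝ ↦ Complex.exp (c * y)) (Complex.exp (c * y) * (c * 1)) y :=
      (((hasDerivAt_id (y : ℂ)).const_mul c).cexp).comp_ofReal
    have hl : HasDerivAt (fun y : ℝ ↦ (1 - y : ℂ)) (-1) y :=
      ((hasDerivAt_id (y : ℂ)).const_sub 1).comp_ofReal
    refine (((hl.mul he).div_const c).add (he.div_const (c ^ 2))).congr_deriv ?_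
    field_simp
    ring
  rw [intervalIntegral.integral_eq_sub_of_hasDerivAt (fun y _ ↦ hd y)
    (Continuous.intervalIntegrable (by fun_prop) _ _)]
  simp
  field_simp
  ring

lemma integral_tent_mul_exp (t : ℝ) :
    ∫ y, (tent y : ℂ) * Complex.exp (t * y * Complex.I) = fejer t := by
  have hcont : Continuous fun y : ℝ ↦ (tent y : ℂ) * Complex.exp (t * y * Complex.I) := by
    have := continuous_tent
    fun_prop
  rw [integral_tent_mul, ← intervalIntegral.integral_add_adjacent_intervals (b := 0)
    (hcont.intervalIntegrable _ _) (hcont.intervalIntegrable _ _)]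
  have h1 : ∫ y in (0 : ℝ)..1, (tent y : ℂ) * Complex.exp (t * y * Complex.I)
      = ∫ y in (0 : ℝ)..1, (1 - y : ℂ) * Complex.exp (t * Complex.I * y) := by
    refine intervalIntegral.integral_congr fun y hy ↦ ?_
    rw [uIcc_of_le zero_le_one] at hy
    simp only [tent, abs_of_nonneg hy.1, max_eq_right (sub_nonneg.mpr hy.2)]
    push_cast
    ring_nf
  have h2 : ∫ y in (-1 : ℝ)..0, (tent y : ℂ) * Complex.exp (t * y * Complex.I)
      = ∫ y in (0 : ℝ)..1, (1 - y : ℂ) * Complex.exp (-(t * Complex.I) * y) := by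
    have := intervalIntegral.integral_comp_neg (a := 0) (b := 1)
      (fun y : ℝ ↦ (tent y : ℂ) * Complex.exp (t * y * Complex.I))
    rw [neg_zero] at this
    rw [← this]
    refine intervalIntegral.integral_congr fun y hy ↦ ?_
    rw [uIcc_of_le zero_le_one] at hy
    simp only [tent, abs_neg, abs_of_nonneg hy.1, max_eq_right (sub_nonneg.mpr hy.2)]
    push_cast
    ring_nf
  rw [h1, h2]
  rcases eq_or_ne t 0 with rfl | ht
  · have : ∫ y in (0 : ℝ)..1, (1 - y : ℂ) = 1 / 2 := by
      have := intervalIntegral.integral_ofReal (a := 0) (b := 1) (μ := volume)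
        (f := fun y : ℝ ↦ 1 - y)
      push_cast at this
      rw [this, intervalIntegral.integral_comp_sub_left (fun y : ℝ ↦ y)]
      norm_num [integral_id]
    simp [this, fejer]
    norm_num
  · have hc : (t * Complex.I : ℂ) ≠ 0 := by simp [ht]
    have ht' : (t : ℂ) ≠ 0 := by simp [ht]
    rw [integral_one_sub_mul_exp hc, integral_one_sub_mul_exp (neg_ne_zero.mpr hc), fejer,
      Real.sinc_of_ne_zero (by simpa using ht)]
    have h3 : Complex.exp (t * Complex.I) + Complex.exp (-(t * Complex.I)) = 2 * Complex.cos t := by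
      rw [Complex.cos]; ring_nf
    have h4 : Complex.cos t = 1 - 2 * Complex.sin (t / 2) ^ 2 := by
      have := Complex.cos_two_mul (t / 2 : ℂ)
      rw [mul_div_cancel₀ _ two_ne_zero] at this
      rw [this, Complex.sin_sq]; ring
    push_cast
    rw [neg_sq, mul_pow, Complex.I_sq, ← add_div]
    have h5 : Complex.exp (-(t * Complex.I)) - 1 - -(t * Complex.I)
      + (Complex.exp (t * Complex.I) - 1 - t * Complex.I) = - 4 * Complex.sin (t / 2) ^ 2 := by
      linear_combination h3 + 2 * h4
    rw [h5]
    field_simp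
    ring

lemma continuous_fejer : Continuous fejer := by
  unfold fejer
  exact (Real.continuous_sinc.comp (continuous_id.div_const 2)).pow 2

lemma fejer_nonneg (t : ℝ) : 0 ≤ fejer t := sq_nonneg _

lemma fejer_le (t : ℝ) : fejer t ≤ 5 * (1 + t ^ 2)⁻¹ := by
  rw [← div_eq_mul_inv, le_div_iff₀ (by positivity)]
  have h1 : fejer t ≤ 1 := (sq_le_one_iff_abs_le_one _).mpr (Real.abs_sinc_le_one _)
  have h2 : fejer t * t ^ 2 ≤ 4 := by
    rcases eq_or_ne t 0 with rfl | ht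
    · norm_num
    · rw [fejer, Real.sinc_of_ne_zero (by simpa using ht)]
      have : (Real.sin (t / 2) / (t / 2)) ^ 2 * t ^ 2 = 4 * Real.sin (t / 2) ^ 2 := by
        field_simp
        ring
      rw [this]
      linarith [Real.sin_sq_le_one (t / 2)]
  linarith

lemma integrable_fejer : Integrable fejer := by
  refine (integrable_inv_one_add_sq.const_mul 5).mono' continuous_fejer.aestronglyMeasurable
    (ae_of_all _ fun t ↦ ?_)
  rw [Real.norm_of_nonneg (fejer_nonneg t)]
  exact fejer_le t

lemma integral_fejer_pos : 0 < ∫ t, fejer t :=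
  integral_pos_of_integrable_nonneg_nonzero (x := 0) continuous_fejer integrable_fejer
    fejer_nonneg (by simp [fejer])

/-! ### Smoothing against the Fejér kernel -/

/-- Fubini's theorem, applied after writing the Fejér kernel as the Fourier transform of the tent
function. The factor `exp (-σ t)` makes the double integral absolutely convergent. -/
lemma integral_mul_fejer_eq {φ : ℝ → ℝ} {M : ℝ} (hφ : Measurable φ) (hM : ∀ t, |φ t| ≤ M)
    {γ : ℂ → ℂ}
    (hγ : ∀ z : ℂ, 0 < z.re → ∫ t in Ioi (0 : ℝ), (φ t : ℂ) * Complex.exp (-z * t) = γ z)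
    (l u : ℝ) {σ : ℝ} (hσ : 0 < σ) :
    ∫ t in Ioi (0 : ℝ), (φ t : ℂ) * Complex.exp (-σ * t) * (fejer (l * (u - t)) : ℂ) =
      ∫ y, (tent y : ℂ) * (Complex.exp (l * u * y * Complex.I) * γ (σ + l * y * Complex.I)) := by
  have hexp : Integrable (fun t : ℝ ↦ (φ t : ℂ) * Complex.exp (-σ * t))
      (volume.restrict (Ioi 0)) := by
    have := integrableOn_exp_mul_complex_Ioi (a := (-σ : ℂ)) (by simpa using hσ) 0
    refine Integrable.bdd_mul (c := M) this (by fun_prop) (ae_of_all _ fun t ↦ ?_)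
    simpa using hM t
  have hint : Integrable (Function.uncurry fun (t y : ℝ) ↦
      Complex.exp (l * (u - t) * y * Complex.I) *
        ((φ t : ℂ) * Complex.exp (-σ * t) * (tent y : ℂ)))
      ((volume.restrict (Ioi 0)).prod volume) := by
    refine Integrable.bdd_mul (c := 1) (hexp.mul_prod integrable_tent)
      (Continuous.aestronglyMeasurable (by fun_prop)) (ae_of_all _ fun p ↦ ?_)
    have := Complex.norm_exp_ofReal_mul_I (l * (u - p.1) * p.2)
    push_cast at this
    exact this.le
  have hswap := integral_integral_swap hint
  calc _ = ∫ t in Ioi (0 : ℝ), ∫ y : ℝ, Complex.exp (l * (u - t) * y * Complex.I) *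
        ((φ t : ℂ) * Complex.exp (-σ * t) * (tent y : ℂ)) := by
        refine integral_congr_ae (ae_of_all _ fun t ↦ ?_)
        have := integral_tent_mul_exp (l * (u - t))
        push_cast at this
        simp only [← this, ← integral_const_mul]
        refine integral_congr_ae (ae_of_all _ fun y ↦ ?_)
        ring
    _ = _ := by
        rw [hswap]
        refine integral_congr_ae (ae_of_all _ fun y ↦ ?_)
        simp only
        rw [← hγ _ (by simpa using hσ), ← integral_const_mul, ← integral_const_mul]
        refine integral_congr_ae (ae_of_all _ fun t ↦ ?_)
        have h1 : Complex.exp (l * (u - t) * y * Complex.I) * Complex.exp (-σ * t) =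
            Complex.exp (l * u * y * Complex.I) * Complex.exp (-(σ + l * y * Complex.I) * t) := by
          rw [← Complex.exp_add, ← Complex.exp_add]; ring_nf
        linear_combination (φ t : ℂ) * (tent y : ℂ) * h1

lemma integrable_fejer_comp {l : ℝ} (hl : l ≠ 0) (u : ℝ) :
    Integrable fun t ↦ fejer (l * (u - t)) :=
  (integrable_fejer.comp_mul_left' hl).comp_sub_left u

/-- The limit `σ → 0+` of `integral_mul_fejer_eq`: the left-hand side converges because `φ` is
bounded and the kernel is integrable, the right-hand side because only a compact part of the
boundary line is involved. -/
lemma integral_mul_fejer_eq_boundary {φ : ℝ → ℝ} {M : ℝ} (hφ : Measurable φ)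
    (hM : ∀ t, |φ t| ≤ M) {γ : ℂ → ℂ} (hc : ContinuousOn γ {z | 0 ≤ z.re})
    (hγ : ∀ z : ℂ, 0 < z.re → ∫ t in Ioi (0 : ℝ), (φ t : ℂ) * Complex.exp (-z * t) = γ z)
    {l : ℝ} (hl : l ≠ 0) (u : ℝ) :
    ∫ t in Ioi (0 : ℝ), (φ t : ℂ) * (fejer (l * (u - t)) : ℂ) =
      ∫ y, (tent y : ℂ) * (Complex.exp (l * u * y * Complex.I) * γ (l * y * Complex.I)) := by
  have hL : Tendsto (fun σ : ℝ ↦ ∫ t in Ioi (0 : ℝ),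
      (φ t : ℂ) * Complex.exp (-σ * t) * (fejer (l * (u - t)) : ℂ)) (𝓝[>] 0)
      (𝓝 (∫ t in Ioi (0 : ℝ), (φ t : ℂ) * (fejer (l * (u - t)) : ℂ))) := by
    have hf := continuous_fejer
    refine tendsto_integral_filter_of_dominated_convergence
      (fun t ↦ M * fejer (l * (u - t))) ?_ ?_ ?_ ?_
    · refine Eventually.of_forall fun σ ↦ ?_
      refine ((Measurable.aestronglyMeasurable (by fun_prop)).mul
        (Continuous.aestronglyMeasurable (by fun_prop))).mul
        (Continuous.aestronglyMeasurable (by fun_prop))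
    · filter_upwards [self_mem_nhdsWithin] with σ (hσ : 0 < σ)
      filter_upwards [ae_restrict_mem measurableSet_Ioi] with t (ht : 0 < t)
      rw [norm_mul, norm_mul, Complex.norm_exp, Complex.norm_real, Complex.norm_real,
        Real.norm_of_nonneg (fejer_nonneg _), Real.norm_eq_abs]
      have h1 : Real.exp (-(σ : ℂ) * t).re ≤ 1 := by
        rw [Real.exp_le_one_iff]
        simp
        positivity
      refine mul_le_mul_of_nonneg_right ?_ (fejer_nonneg _)
      calc _ ≤ M * 1 := by
            gcongr
            · exact (abs_nonneg _).trans (hM t)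
            · exact hM t
        _ = M := mul_one M
    · exact ((integrable_fejer_comp hl u).const_mul M).restrict
    · refine ae_of_all _ fun t ↦ ?_
      refine tendsto_nhdsWithin_of_tendsto_nhds ?_
      have : Continuous fun σ : ℝ ↦
          (φ t : ℂ) * Complex.exp (-σ * t) * (fejer (l * (u - t)) : ℂ) := by fun_prop
      simpa using this.tendsto 0
  have hR : Tendsto (fun σ : ℝ ↦ ∫ y, (tent y : ℂ) *
      (Complex.exp (l * u * y * Complex.I) * γ (σ + l * y * Complex.I))) (𝓝[>] 0)
      (𝓝 (∫ y, (tent y : ℂ) * (Complex.exp (l * u * y * Complex.I) * γ (l * y * Complex.I)))) := by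
    -- Replacing `σ` by `max σ 0` gives a function continuous on the whole plane, to which the
    -- continuity theorem for integrals with a parameter applies.
    have hg : Continuous fun p : ℝ × ℝ ↦ γ ((max p.1 0 : ℝ) + l * p.2 * Complex.I) := by
      refine hc.comp_continuous (by fun_prop) fun p ↦ ?_
      simp
    have hcont : Continuous fun σ : ℝ ↦ ∫ y in (-1 : ℝ)..1, (tent y : ℂ) *
        (Complex.exp (l * u * y * Complex.I) * γ ((max σ 0 : ℝ) + l * y * Complex.I)) := by
      refine intervalIntegral.continuous_parametric_intervalIntegral_of_continuous' ?_ _ _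
      have := continuous_tent
      exact (Complex.continuous_ofReal.comp (this.comp continuous_snd)).mul
        (Continuous.mul (by fun_prop) hg)
    simp only [integral_tent_mul]
    have h0 := (hcont.tendsto 0).mono_left (nhdsWithin_le_nhds (s := Ioi 0))
    simp only [max_self, Complex.ofReal_zero, zero_add] at h0
    refine h0.congr' ?_
    filter_upwards [self_mem_nhdsWithin] with σ (hσ : 0 < σ)
    rw [max_eq_left hσ.le]
  refine tendsto_nhds_unique (hL.congr' ?_) hR
  filter_upwards [self_mem_nhdsWithin] with σ (hσ : 0 < σ)
  exact integral_mul_fejer_eq hφ hM hγ l u hσ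

lemma tendsto_integral_Ioi_mul_fejer {φ : ℝ → ℝ} {M : ℝ} (hφ : Measurable φ)
    (hM : ∀ t, |φ t| ≤ M) {γ : ℂ → ℂ} (hc : ContinuousOn γ {z | 0 ≤ z.re})
    (hγ : ∀ z : ℂ, 0 < z.re → ∫ t in Ioi (0 : ℝ), (φ t : ℂ) * Complex.exp (-z * t) = γ z)
    {l : ℝ} (hl : 0 < l) :
    Tendsto (fun u ↦ ∫ t in Ioi (0 : ℝ), φ t * fejer (l * (u - t))) atTop (𝓝 0) := by
  have hRL := Real.tendsto_integral_exp_smul_cocompact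
    (fun y : ℝ ↦ (tent y : ℂ) * γ (l * y * Complex.I))
  -- Mathlib's Fourier character is `exp (2π i ·)`, whence the factor `2π`.
  have hw : Tendsto (fun u : ℝ ↦ -(l / (2 * Real.pi)) * u) atTop (cocompact ℝ) := by
    refine (tendsto_id.const_mul_atTop_of_neg ?_).mono_right atBot_le_cocompact
    have := Real.pi_pos
    simpa using (by positivity : 0 < l / (2 * Real.pi))
  have h := hRL.comp hw
  rw [← Filter.tendsto_ofReal_iff]
  refine (h.congr fun u ↦ ?_).trans_eq (by simp)
  rw [← integral_complex_ofReal]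
  push_cast
  rw [integral_mul_fejer_eq_boundary hφ hM hc hγ hl.ne']
  refine integral_congr_ae (ae_of_all _ fun y ↦ ?_)
  simp only [Circle.smul_def, Real.fourierChar_apply, smul_eq_mul]
  have : (Real.pi : ℂ) ≠ 0 := by simp [Real.pi_ne_zero]
  rw [show ((2 * Real.pi * -(y * (-(l / (2 * Real.pi)) * u)) : ℝ) : ℂ) = l * u * y by
    push_cast; field_simp]
  ring

lemma tendsto_fejer_atTop : Tendsto fejer atTop (𝓝 0) := by
  refine squeeze_zero fejer_nonneg fejer_le ?_
  have : Tendsto (fun t : ℝ ↦ 1 + t ^ 2) atTop atTop :=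
    tendsto_atTop_add_const_left _ _ (tendsto_pow_atTop two_ne_zero)
  simpa using this.inv_tendsto_atTop.const_mul 5

lemma tendsto_integral_Iic_mul_fejer {φ : ℝ → ℝ} {M : ℝ} (hφ : Measurable φ)
    (hM : ∀ t, |φ t| ≤ M) {l : ℝ} (hl : 0 < l) :
    Tendsto (fun u ↦ ∫ t in Iic (0 : ℝ), φ t * fejer (l * (u - t))) atTop (𝓝 0) := by
  have hf := continuous_fejer
  have hM0 : 0 ≤ M := (abs_nonneg _).trans (hM 0)
  have h : Tendsto (fun u ↦ ∫ t in Iic (0 : ℝ), φ t * fejer (l * (u - t))) atTop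
      (𝓝 (∫ t in Iic (0 : ℝ), (0 : ℝ))) := by
    refine tendsto_integral_filter_of_dominated_convergence
      (fun t ↦ M * (5 * (1 + (l * t) ^ 2)⁻¹)) ?_ ?_ ?_ ?_
    · exact Eventually.of_forall fun u ↦
        hφ.aestronglyMeasurable.mul (Continuous.aestronglyMeasurable (by fun_prop))
    · filter_upwards [eventually_ge_atTop 0] with u hu
      filter_upwards [ae_restrict_mem measurableSet_Iic] with t (ht : t ≤ 0)
      rw [norm_mul, Real.norm_of_nonneg (fejer_nonneg _), Real.norm_eq_abs]
      refine mul_le_mul (hM t) ((fejer_le _).trans ?_) (fejer_nonneg _) hM0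
      have : t ^ 2 ≤ (u - t) ^ 2 := by nlinarith
      rw [mul_pow, mul_pow]
      gcongr
    · exact (((integrable_inv_one_add_sq.comp_mul_left' hl.ne').const_mul 5).const_mul M).restrict
    · refine ae_of_all _ fun t ↦ ?_
      have : Tendsto (fun u ↦ l * (u - t)) atTop atTop :=
        (tendsto_atTop_add_const_right _ (-t) tendsto_id).const_mul_atTop hl
      simpa using (tendsto_fejer_atTop.comp this).const_mul (φ t)
  simpa using h

/-- All Fejér averages of `a` converge as if `a` were the constant `1`. Larger `l` means a narrower
kernel. The kernel sees `a` on the whole line, but the contribution of `(-∞, 0]`, about which the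
Laplace transform says nothing, vanishes in the limit. -/
lemma tendsto_integral_comp_mul_fejer {a : ℝ → ℝ} {M : ℝ} (ha : Measurable a)
    (hM : ∀ t, |a t| ≤ M) {γ : ℂ → ℂ} (hc : ContinuousOn γ {z | 0 ≤ z.re})
    (hγ : ∀ z : ℂ, 0 < z.re →
      ∫ t in Ioi (0 : ℝ), ((a t - 1 : ℝ) : ℂ) * Complex.exp (-z * t) = γ z)
    {l : ℝ} (hl : 0 < l) :
    Tendsto (fun u ↦ ∫ r, a (u - r / l) * fejer r) atTop (𝓝 (∫ r, fejer r)) := by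
  have hφ : Measurable fun t ↦ a t - 1 := ha.sub_const 1
  have hφM : ∀ t, |a t - 1| ≤ M + 1 := fun t ↦
    (abs_sub _ _).trans (by simpa using hM t)
  have hint : ∀ u, Integrable fun t ↦ (a t - 1) * fejer (l * (u - t)) := fun u ↦
    (integrable_fejer_comp hl.ne' u).bdd_mul (c := M + 1) hφ.aestronglyMeasurable
      (ae_of_all _ fun t ↦ hφM t)
  have h := ((tendsto_integral_Iic_mul_fejer hφ hφM hl).add
    (tendsto_integral_Ioi_mul_fejer hφ hφM hc hγ hl)).const_mul l
  have h2 : Tendsto (fun u ↦ ∫ r, (a (u - r / l) - 1) * fejer r) atTop (𝓝 0) := by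
    refine (h.congr fun u ↦ ?_).trans_eq (by simp)
    rw [← compl_Iic, integral_add_compl measurableSet_Iic (hint u),
      ← integral_sub_left_eq_self (fun t ↦ (a t - 1) * fejer (l * (u - t))) volume u]
    have := Measure.integral_comp_mul_left (fun r ↦ (a (u - r / l) - 1) * fejer r) l
    rw [abs_of_pos (inv_pos.mpr hl), smul_eq_mul, eq_inv_mul_iff_mul_eq₀ hl.ne'] at this
    rw [← this]
    congr 1
    refine integral_congr_ae (ae_of_all _ fun s ↦ ?_)
    simp only [sub_sub_cancel, mul_div_cancel_left₀ _ hl.ne']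
  have h3 := h2.add_const (∫ r, fejer r)
  rw [zero_add] at h3
  refine h3.congr fun u ↦ ?_
  rw [← integral_add _ integrable_fejer]
  · exact integral_congr_ae (ae_of_all _ fun r ↦ by ring)
  · refine integrable_fejer.bdd_mul (c := M + 1)
      (Measurable.aestronglyMeasurable (by fun_prop)) (ae_of_all _ fun t ↦ hφM _)

lemma integrable_comp_mul_fejer {a : ℝ → ℝ} {M : ℝ} (ha : Measurable a)
    (hM : ∀ t, |a t| ≤ M) (l u : ℝ) : Integrable fun r ↦ a (u - r / l) * fejer r :=
  integrable_fejer.bdd_mul (c := M) (Measurable.aestronglyMeasurable (by fun_prop))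
    (ae_of_all _ fun _ ↦ hM _)

/-! ### The Tauberian theorem -/

/-- Slow decrease: over an interval of length `d`, the function `a` loses at most a factor
`exp (-d)`. -/
lemma exp_neg_mul_le_of_monotone {a : ℝ → ℝ} (h0 : ∀ t, 0 ≤ a t)
    (hmono : Monotone fun t ↦ a t * Real.exp t) {s t d : ℝ} (hst : s ≤ t) (hd : t - s ≤ d) :
    Real.exp (-d) * a s ≤ a t := by
  have h1 : a s * Real.exp s ≤ a t * Real.exp t := hmono hst
  have h2 : Real.exp (-d) * Real.exp t ≤ Real.exp s := by
    rw [← Real.exp_add]; exact Real.exp_le_exp.mpr (by linarith)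
  have h3 : Real.exp (-d) * a s * Real.exp t ≤ a t * Real.exp t := by
    nlinarith [h0 s]
  exact le_of_mul_le_mul_right h3 (Real.exp_pos t)

lemma le_integral_comp_mul_fejer {a : ℝ → ℝ} {M : ℝ} (ha : Measurable a) (h0 : ∀ t, 0 ≤ a t)
    (hM : ∀ t, |a t| ≤ M) (hmono : Monotone fun t ↦ a t * Real.exp t) {l A : ℝ} (hl : 0 < l)
    (u : ℝ) :
    Real.exp (-(2 * (A / l))) * a (u - A / l) * ∫ r in Ioc (-A) A, fejer r ≤
      ∫ r, a (u - r / l) * fejer r := by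
  have hI := integrable_comp_mul_fejer ha hM l u
  refine le_trans ?_ (setIntegral_le_integral (s := Ioc (-A) A) hI
    (ae_of_all _ fun r ↦ mul_nonneg (h0 _) (fejer_nonneg _)))
  rw [← integral_const_mul]
  refine setIntegral_mono_on (integrable_fejer.const_mul _).integrableOn hI.integrableOn
    measurableSet_Ioc fun r hr ↦ mul_le_mul_of_nonneg_right ?_ (fejer_nonneg _)
  have h1 : r / l ≤ A / l := by gcongr; exact hr.2
  have h2 : -A / l ≤ r / l := by gcongr; exact hr.1.le
  rw [neg_div] at h2
  exact exp_neg_mul_le_of_monotone h0 hmono (by linarith) (by linarith)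

lemma integral_comp_mul_fejer_le {a : ℝ → ℝ} {M : ℝ} (ha : Measurable a) (h0 : ∀ t, 0 ≤ a t)
    (hM : ∀ t, |a t| ≤ M) (hmono : Monotone fun t ↦ a t * Real.exp t) {l A : ℝ} (hl : 0 < l)
    (u : ℝ) :
    ∫ r, a (u - r / l) * fejer r ≤
      Real.exp (2 * (A / l)) * a (u + A / l) * (∫ r in Ioc (-A) A, fejer r) +
        M * ((∫ r, fejer r) - ∫ r in Ioc (-A) A, fejer r) := by
  have hI := integrable_comp_mul_fejer ha hM l u
  rw [← integral_add_compl measurableSet_Ioc hI (s := Ioc (-A) A),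
    ← integral_add_compl measurableSet_Ioc integrable_fejer (s := Ioc (-A) A),
    add_sub_cancel_left, ← integral_const_mul, ← integral_const_mul]
  refine add_le_add (setIntegral_mono_on hI.integrableOn
    (integrable_fejer.const_mul _).integrableOn measurableSet_Ioc fun r hr ↦
      mul_le_mul_of_nonneg_right ?_ (fejer_nonneg _))
    (setIntegral_mono hI.integrableOn (integrable_fejer.const_mul _).integrableOn fun r ↦
      mul_le_mul_of_nonneg_right ((le_abs_self _).trans (hM _)) (fejer_nonneg _))
  have h1 : r / l ≤ A / l := by gcongr; exact hr.2
  have h2 : -A / l ≤ r / l := by gcongr; exact hr.1.le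
  rw [neg_div] at h2
  have := exp_neg_mul_le_of_monotone h0 hmono (s := u - r / l) (t := u + A / l)
    (d := 2 * (A / l)) (by linarith) (by linarith)
  rwa [Real.exp_neg, inv_mul_le_iff₀ (Real.exp_pos _)] at this

/-- A Wiener-Ikehara theorem for bounded `a`: if `a t * exp t` is monotone and the Laplace transform
of `a - 1` extends continuously to the closed right half-plane, then `a` tends to `1`. -/
theorem tendsto_one_of_laplace_continuousOn {a : ℝ → ℝ} {M : ℝ} (ha : Measurable a)
    (h0 : ∀ t, 0 ≤ a t) (hM : ∀ t, |a t| ≤ M) (hmono : Monotone fun t ↦ a t * Real.exp t)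
    {γ : ℂ → ℂ} (hc : ContinuousOn γ {z | 0 ≤ z.re})
    (hγ : ∀ z : ℂ, 0 < z.re →
      ∫ t in Ioi (0 : ℝ), ((a t - 1 : ℝ) : ℂ) * Complex.exp (-z * t) = γ z) :
    Tendsto a atTop (𝓝 1) := by
  set c := ∫ r, fejer r with hcdef
  have hcpos : 0 < c := integral_fejer_pos
  set m : ℝ → ℝ := fun A ↦ ∫ r in Ioc (-A) A, fejer r with hm
  have hmc : Tendsto m atTop (𝓝 c) := by
    have := intervalIntegral_tendsto_integral integrable_fejer tendsto_neg_atTop_atBot tendsto_id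
    refine this.congr' ?_
    filter_upwards [eventually_ge_atTop 0] with A hA
    rw [intervalIntegral.integral_of_le (by simp only [id]; linarith)]
    rfl
  -- The window `|r| ≤ A` of the kernel of width `1 / A ^ 2` corresponds to `|t - u| ≤ A / A ^ 2`:
  -- as `A → ∞` it captures almost all the mass of the kernel and still shrinks to a point.
  have hd : Tendsto (fun A : ℝ ↦ A / A ^ 2) atTop (𝓝 0) := by
    refine tendsto_inv_atTop_zero.congr fun A ↦ ?_
    rw [sq, div_self_mul_self']
  refine tendsto_order.2 ⟨fun b hb ↦ ?_, fun b hb ↦ ?_⟩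
  · have hlim : Tendsto (fun A : ℝ ↦ Real.exp (2 * (A / A ^ 2)) * b * m A + M * (c - m A)) atTop
        (𝓝 (Real.exp (2 * 0) * b * c + M * (c - c))) :=
      ((((hd.const_mul 2).rexp).mul_const b).mul hmc).add ((hmc.const_sub c).const_mul M)
    obtain ⟨A, hA, hmA, hA0⟩ := ((hlim.eventually_lt_const
      (by simpa using mul_lt_of_lt_one_left hcpos hb : _ < c)).and
      ((hmc.eventually_const_lt hcpos).and (eventually_gt_atTop 0))).exists
    have hl : (0 : ℝ) < A ^ 2 := by positivity
    have hev := (tendsto_integral_comp_mul_fejer ha hM hc hγ hl).eventually_const_lt hA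
    have hsh : Tendsto (fun t : ℝ ↦ t - A / A ^ 2) atTop atTop :=
      tendsto_atTop_add_const_right _ _ tendsto_id
    filter_upwards [hsh.eventually hev] with t ht
    have h1 := ht.trans_le (integral_comp_mul_fejer_le ha h0 hM hmono (A := A) hl _)
    rw [sub_add_cancel] at h1
    have h2 : Real.exp (2 * (A / A ^ 2)) * b * m A < Real.exp (2 * (A / A ^ 2)) * a t * m A := by
      linarith
    exact lt_of_mul_lt_mul_left (lt_of_mul_lt_mul_right h2 hmA.le) (Real.exp_pos _).le
  · have hlim : Tendsto (fun A : ℝ ↦ Real.exp (-(2 * (A / A ^ 2))) * b * m A) atTop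
        (𝓝 (Real.exp (-(2 * 0)) * b * c)) :=
      (((hd.const_mul 2).neg.rexp).mul_const b).mul hmc
    obtain ⟨A, hA, hmA, hA0⟩ := ((hlim.eventually_const_lt
      (by simpa using lt_mul_of_one_lt_left hcpos hb : c < _)).and
      ((hmc.eventually_const_lt hcpos).and (eventually_gt_atTop 0))).exists
    have hl : (0 : ℝ) < A ^ 2 := by positivity
    have hev := (tendsto_integral_comp_mul_fejer ha hM hc hγ hl).eventually_lt_const hA
    have hsh : Tendsto (fun t : ℝ ↦ t + A / A ^ 2) atTop atTop :=
      tendsto_atTop_add_const_right _ _ tendsto_id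
    filter_upwards [hsh.eventually hev] with t ht
    have h1 := (le_integral_comp_mul_fejer ha h0 hM hmono (A := A) hl _).trans_lt ht
    rw [add_sub_cancel_right] at h1
    exact lt_of_mul_lt_mul_left (lt_of_mul_lt_mul_right h1 hmA.le) (Real.exp_pos _).le

/-! ### The Laplace transform of Chebyshev's function -/

open ArithmeticFunction.vonMangoldt (LFunctionResidueClassAux)

lemma sum_Icc_vonMangoldt_eq_psi (x : ℝ) :
    ∑ n ∈ Finset.Icc 1 ⌊x⌋₊, Λ n = Chebyshev.psi x := rfl

lemma LSeries_vonMangoldt_eq_mul_integral {s : ℂ} (hs : 1 < s.re) :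
    LSeries (fun n ↦ (Λ n : ℂ)) s =
      s * ∫ x in Ioi (1 : ℝ), (Chebyshev.psi x : ℂ) * (x : ℂ) ^ (-(s + 1)) := by
  have hO : (fun n ↦ ∑ k ∈ Finset.Icc 1 n, Λ k) =O[atTop] fun n ↦ (n : ℝ) ^ (1 : ℝ) := by
    refine Asymptotics.IsBigO.of_bound (Real.log 4 + 4) (Eventually.of_forall fun n ↦ ?_)
    have := sum_Icc_vonMangoldt_eq_psi n
    rw [Nat.floor_natCast] at this
    rw [this, Real.rpow_one, Real.norm_of_nonneg (Chebyshev.psi_nonneg _),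
      Real.norm_of_nonneg n.cast_nonneg]
    exact Chebyshev.psi_le_const_mul_self n.cast_nonneg
  rw [LSeries_eq_mul_integral_of_nonneg _ zero_le_one hs hO
    fun _ ↦ ArithmeticFunction.vonMangoldt_nonneg]
  simp_rw [← sum_Icc_vonMangoldt_eq_psi]
  push_cast
  rfl

lemma image_exp_Ioi_zero : Real.exp '' Ioi 0 = Ioi 1 := by
  ext x
  constructor
  · rintro ⟨t, ht, rfl⟩
    exact Real.one_lt_exp_iff.mpr ht
  · intro (hx : 1 < x)
    exact ⟨Real.log x, Real.log_pos hx, Real.exp_log (by linarith)⟩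

/-- Chebyshev's function in logarithmic scale, `ψ (exp t) / exp t`. -/
noncomputable def psiExp (t : ℝ) : ℝ := Chebyshev.psi (Real.exp t) * Real.exp (-t)

lemma psiExp_nonneg (t : ℝ) : 0 ≤ psiExp t :=
  mul_nonneg (Chebyshev.psi_nonneg _) (Real.exp_pos _).le

lemma psiExp_mul_exp (t : ℝ) : psiExp t * Real.exp t = Chebyshev.psi (Real.exp t) := by
  rw [psiExp, mul_assoc, ← Real.exp_add, neg_add_cancel, Real.exp_zero, mul_one]

lemma abs_psiExp_le (t : ℝ) : |psiExp t| ≤ Real.log 4 + 4 := by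
  rw [abs_of_nonneg (psiExp_nonneg t)]
  refine le_of_mul_le_mul_right ?_ (Real.exp_pos t)
  rw [psiExp_mul_exp]
  exact Chebyshev.psi_le_const_mul_self (Real.exp_pos t).le

lemma measurable_psiExp : Measurable psiExp :=
  (Chebyshev.psi_mono.measurable.comp Real.measurable_exp).mul (by fun_prop)

lemma integral_psiExp_mul_exp {z : ℂ} (hz : 0 < z.re) :
    ∫ t in Ioi (0 : ℝ), (psiExp t : ℂ) * Complex.exp (-z * t) =
      LSeries (fun n ↦ (Λ n : ℂ)) (1 + z) / (1 + z) := by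
  have hs : 1 < (1 + z).re := by simpa using hz
  have hs0 : 1 + z ≠ 0 := fun h ↦ by rw [h] at hs; norm_num at hs
  rw [LSeries_vonMangoldt_eq_mul_integral hs, mul_div_cancel_left₀ _ hs0, ← image_exp_Ioi_zero,
    integral_image_eq_integral_abs_deriv_smul measurableSet_Ioi
      (fun t _ ↦ (Real.hasDerivAt_exp t).hasDerivWithinAt) Real.exp_injective.injOn]
  refine integral_congr_ae (ae_of_all _ fun t ↦ ?_)
  have he : ((Real.exp t : ℝ) : ℂ) ^ (-(1 + z + 1)) = Complex.exp (t * (-(1 + z + 1))) := by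
    rw [Complex.cpow_def_of_ne_zero (by simp [Complex.exp_ne_zero]), ← Complex.ofReal_log
      (Real.exp_pos t).le, Real.log_exp]
  simp only [psiExp, he, abs_of_pos (Real.exp_pos t), Complex.real_smul]
  push_cast
  have h : Complex.exp (-t) * Complex.exp (-z * t) =
      Complex.exp t * Complex.exp (t * (-(1 + z + 1))) := by
    rw [← Complex.exp_add, ← Complex.exp_add]; ring_nf
  linear_combination (Chebyshev.psi (Real.exp t) : ℂ) * h

/-- Separation of the pole of `L(Λ, s) = -ζ'/ζ (s)` at `s = 1`. Modulo `1` there is a single residue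
class, so Mathlib's function for primes in residue classes is `-ζ'/ζ (s) - 1 / (s - 1)`. -/
lemma LSeries_vonMangoldt_eq {s : ℂ} (hs : 1 < s.re) :
    LSeries (fun n ↦ (Λ n : ℂ)) s = LFunctionResidueClassAux (1 : ZMod 1) s + 1 / (s - 1) := by
  have h := ArithmeticFunction.vonMangoldt.eqOn_LFunctionResidueClassAux
    (isUnit_one : IsUnit (1 : ZMod 1)) hs
  have hr : ArithmeticFunction.vonMangoldt.residueClass (1 : ZMod 1) = fun n ↦ Λ n := by
    ext n
    exact indicator_of_mem (s := {n : ℕ | (n : ZMod 1) = 1})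
      (Subsingleton.elim (n : ZMod 1) 1) fun n ↦ Λ n
  simp only [hr, Nat.totient_one, Nat.cast_one, inv_one] at h
  rw [h]; ring

lemma integral_psiExp_sub_one_mul_exp {z : ℂ} (hz : 0 < z.re) :
    ∫ t in Ioi (0 : ℝ), ((psiExp t - 1 : ℝ) : ℂ) * Complex.exp (-z * t) =
      (LFunctionResidueClassAux (1 : ZMod 1) (1 + z) - 1) / (1 + z) := by
  have hexp : IntegrableOn (fun t : ℝ ↦ Complex.exp (-z * t)) (Ioi 0) :=
    integrableOn_exp_mul_complex_Ioi (by simpa using hz) 0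
  have hs : 1 < (1 + z).re := by simpa using hz
  have hs0 : 1 + z ≠ 0 := fun h ↦ by rw [h] at hs; norm_num at hs
  have hz0 : z ≠ 0 := fun h ↦ by simp [h] at hz
  have hm := measurable_psiExp
  have hi : IntegrableOn (fun t : ℝ ↦ (psiExp t : ℂ) * Complex.exp (-z * t)) (Ioi 0) :=
    Integrable.bdd_mul (c := Real.log 4 + 4) hexp (by fun_prop)
      (ae_of_all _ fun t ↦ by simpa using abs_psiExp_le t)
  simp only [Complex.ofReal_sub, Complex.ofReal_one, sub_mul, one_mul]
  rw [integral_sub hi hexp, integral_psiExp_mul_exp hz, LSeries_vonMangoldt_eq hs,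
    integral_exp_mul_complex_Ioi (by simpa using hz)]
  simp
  field_simp
  ring

/-! ### The prime number theorem -/

lemma tendsto_psiExp : Tendsto psiExp atTop (𝓝 1) := by
  refine tendsto_one_of_laplace_continuousOn measurable_psiExp psiExp_nonneg abs_psiExp_le ?_ ?_
    fun z ↦ integral_psiExp_sub_one_mul_exp
  · simp only [psiExp_mul_exp]
    exact Chebyshev.psi_mono.comp Real.exp_monotone
  · have hre : ∀ z ∈ {z : ℂ | 0 ≤ z.re}, 1 ≤ (1 + z).re := fun z (hz : 0 ≤ z.re) ↦ by simpa using hz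
    refine ContinuousOn.div ?_ (by fun_prop) fun z hz h ↦ ?_
    · exact ((ArithmeticFunction.vonMangoldt.continuousOn_LFunctionResidueClassAux 1).comp
        (by fun_prop) hre).sub continuousOn_const
    · have := hre z hz
      rw [h] at this
      norm_num at this

theorem tendsto_psi_div : Tendsto (fun x ↦ Chebyshev.psi x / x) atTop (𝓝 1) := by
  refine (tendsto_psiExp.comp Real.tendsto_log_atTop).congr' ?_
  filter_upwards [eventually_gt_atTop 0] with x hx
  simp only [Function.comp, psiExp, Real.exp_neg, Real.exp_log hx, div_eq_mul_inv]

theorem theorem2p6 :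
    (fun N : ℕ => (1 / (N : ℝ)) * (∑ n ∈ Finset.Icc 1 N, ArithmeticFunction.vonMangoldt n) - 1)
      =o[Filter.atTop] (fun _ : ℕ => (1 : ℝ)) := by
  rw [Asymptotics.isLittleO_one_iff]
  have h := (tendsto_psi_div.comp tendsto_natCast_atTop_atTop).sub_const 1
  rw [sub_self] at h
  refine h.congr fun N ↦ ?_
  simp only [Function.comp, ← sum_Icc_vonMangoldt_eq_psi, Nat.floor_natCast]
  ring
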